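/- All sets below are subsets of $\omega=\{0,1,2,\dots\}$. Write $X'$ for the Turing jump of $X$; $X$ is \emph{low} if $X'\leq_{\mathrm T}\emptyset'$. A \emph{Turing ideal} is a non-empty family $\mathcal M$ of sets that is closed downward under $\leq_{\mathrm T}$ and closed under the join $\oplus$. A \emph{Scott ideal} is a Turing ideal $\mathcal M$ such that every infinite binary tree $T\subseteq 2^{<\omega}$ in $\mathcal M$ has an infinite path in $\mathcal M$. A set $Z$ \emph{codes} $\mathcal M$ if $\mathcal M=\{Z_0,Z_1,\dots\}$, where $Z_i=\{n:\langle i,n\rangle\in Z\}$. Let $\mathcal M$ be a Turing ideal. For an infinite set $X\in\mathcal M$, a property $\varphi(D)$ of (canonical indices of) finite sets $D$ is \emph{$\mathcal M$-densely essential within $X$} if for every infinite $Y\subseteq X$ with $Y\in\mathcal M$ there is a non-empty finite set $D\subseteq Y$ such that $\varphi(D)$ holds. A set $A$ is \emph{densely $\mathcal M$-hyperimmune} if for every infinite $X\in\mathcal M$ and every $\Sigma^0_1(X)$ property $\varphi$ that is $\mathcal M$-densely essential within $X$, there is a finite set $D\subseteq X\cap\overline A$ such that $\varphi(D)$ holds.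 \textbf{Theorem.} Let $\mathcal M$ be a Scott ideal coded by a low set, and let $A$ be a $\Delta^0_2$ set that is not densely $\mathcal M$-hyperimmune. Then there is a low infinite set $G\subseteq A$. -/

import Mathlib

open Classical in
/-- The characteristic function of a set of natural numbers, as an oracle. -/
noncomputable def charFun (A : Set ℕ) : ℕ →. ℕ :=
  fun n => Part.some (if n ∈ A then 1 else 0)

/-- `A ≤_T B`: Turing reducibility between sets of natural numbers. -/
def SetTuringReducible (A B : Set ℕ) : Prop :=
  TuringReducible (charFun A) (charFun B)

/-- The join `A ⊕ B = {2n : n ∈ A} ∪ {2n + 1 : n ∈ B}`. -/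
def setJoin (A B : Set ℕ) : Set ℕ :=
  {m | ∃ n, (n ∈ A ∧ m = 2 * n) ∨ (n ∈ B ∧ m = 2 * n + 1)}

open Classical in
/-- The initial segment of length `s` of (the characteristic function of) `X`, a finite
binary string. -/
noncomputable def initSeg (X : Set ℕ) (s : ℕ) : List Bool :=
  (List.range s).map fun i => decide (i ∈ X)

/-- The `e`-th set `W_e^X` computably enumerable in the oracle `X`. The `e`-th oracle machine is
the `e`-th partial recursive function, run on the input `n` together with a finite initial segment
`σ` of the oracle, and `n ∈ W_e^X` if this computation halts for some `σ` which is an initial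
segment of `X`. (The sets `W_e^X` are exactly the domains of the partial functions recursive in
`X`; the numbering of codes is Mathlib's, so the `s-m-n` theorem holds for it.) -/
def relREnum (e : ℕ) (X : Set ℕ) : Set ℕ :=
  {n | ∃ s, ((Denumerable.ofNat Nat.Partrec.Code e).eval
    (Nat.pair n (Encodable.encode (initSeg X s)))).Dom}

/-- The Turing jump `X' = {e : e ∈ W_e^X}`. -/
def turingJump (X : Set ℕ) : Set ℕ :=
  {e | e ∈ relREnum e X}

/-- `X` is low: `X' ≤_T ∅'`. -/
def IsLow (X : Set ℕ) : Prop :=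
  SetTuringReducible (turingJump X) (turingJump ∅)

/-- `A` is `Σ⁰₂`: `n ∈ A ↔ ∃ x, ∀ y, R (n, x, y)` with `R` computable. -/
def IsSigma02 (A : Set ℕ) : Prop :=
  ∃ R : ℕ × ℕ × ℕ → Prop, ComputablePred R ∧ ∀ n, n ∈ A ↔ ∃ x, ∀ y, R (n, x, y)

/-- `A` is `Δ⁰₂`: both `A` and its complement are `Σ⁰₂`. -/
def IsDelta02 (A : Set ℕ) : Prop :=
  IsSigma02 A ∧ IsSigma02 Aᶜ

/-- A Turing ideal: a nonempty family of sets which is closed downward under Turing reducibility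
and closed under joins. -/
structure IsTuringIdeal (M : Set (Set ℕ)) : Prop where
  nonempty : M.Nonempty
  downward : ∀ A B : Set ℕ, A ∈ M → SetTuringReducible B A → B ∈ M
  join : ∀ A B : Set ℕ, A ∈ M → B ∈ M → setJoin A B ∈ M

/-- A binary tree: a set of finite binary strings closed under initial segments. -/
def IsBinaryTree (T : Set (List Bool)) : Prop :=
  ∀ σ τ : List Bool, σ <+: τ → τ ∈ T → σ ∈ T

/-- A Scott ideal: a Turing ideal `M` satisfying weak König's lemma, i.e. every infinite binary
tree (coded as a set of numbers) in `M` has an infinite path in `M`. -/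
structure IsScottIdeal (M : Set (Set ℕ)) : Prop extends IsTuringIdeal M where
  wkl : ∀ T : Set (List Bool), IsBinaryTree T → T.Infinite → Encodable.encode '' T ∈ M →
    ∃ P ∈ M, ∀ s, initSeg P s ∈ T

/-- The set `Z` codes the countable family `M`: `Z = ⊕ᵢ Zᵢ` with `M = {Z₀, Z₁, …}`. -/
def CodesFamily (Z : Set ℕ) (M : Set (Set ℕ)) : Prop :=
  M = Set.range fun i : ℕ => {n | Nat.pair i n ∈ Z}

/-- The canonical index `∑_{i ∈ D} 2 ^ i` of the finite set `D`. -/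
def canonicalIndex (D : Finset ℕ) : ℕ :=
  ∑ i ∈ D, 2 ^ i

/-- `φ` is a `Σ⁰₁(X)` property of (canonical indices of) finite sets:
`φ(D) ↔ ∃ w, R(D, w)` with `R` computable in `X`. -/
def IsSigma01In (X : Set ℕ) (φ : Finset ℕ → Prop) : Prop :=
  ∃ R : Set ℕ, SetTuringReducible R X ∧ ∀ D, φ D ↔ ∃ w, Nat.pair (canonicalIndex D) w ∈ R

/-- `φ` is `M`-densely essential within `X`. -/
def IsDenselyEssential (M : Set (Set ℕ)) (X : Set ℕ) (φ : Finset ℕ → Prop) : Prop :=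
  ∀ Y ∈ M, Y.Infinite → Y ⊆ X → ∃ D : Finset ℕ, D.Nonempty ∧ (D : Set ℕ) ⊆ Y ∧ φ D

/-- `A` is densely `M`-hyperimmune. -/
def IsDenselyHyperimmune (M : Set (Set ℕ)) (A : Set ℕ) : Prop :=
  ∀ X ∈ M, X.Infinite → ∀ φ : Finset ℕ → Prop, IsSigma01In X φ → IsDenselyEssential M X φ →
    ∃ D : Finset ℕ, (D : Set ℕ) ⊆ X ∩ Aᶜ ∧ φ D

/-! The proof is Mathias forcing with reservoirs in `M`, carried out below `∅'`. Failure of dense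
hyperimmunity yields an infinite `X ∈ M` and a `Σ⁰₁(X)` property `φ`, densely essential within `X`,
such that every finite `D ⊆ X` with `φ D` meets `A`. Hence `A` meets every infinite `Y ⊆ X` in `M`,
arbitrarily far out. A condition is a string `σ` with a reservoir `Y`. To decide `e ∈ G'`, first add
an element of `A ∩ Y` to `σ`. If some further extension by elements of `A ∩ Y` makes the machine
halt, take it and keep `Y`. Otherwise `A ∩ Y` belongs to the class `IsAvoiding` of all `P ⊆ Y` that
meet every `φ`-set inside `Y` and from which no extension halts. This class is `Π⁰₁` in members of
`M`, so it has a member in the Scott ideal (`IsScottIdeal.exists_isAvoiding`). That member is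
infinite because it meets `φ`-sets in every tail of `Y` (`IsAvoiding.infinite`), and it is the new
reservoir. Reservoirs are named by indices in the low code `Z`. Whether one condition is a correct
next step after another is decidable from `A` and `Z'`, hence from `∅'`
(`computableIn_isDecidingExtension`), so `∅'` finds the sequence by search and reads the jump of `G`
off the flags. -/

open Encodable

/-! ### Relative computability: composition, recursion and unbounded search. -/

namespace ComputableIn

variable {α β γ σ : Type*} [Primcodable α] [Primcodable β] [Primcodable γ] [Primcodable σ]
variable {O : Set (ℕ →. ℕ)}

theorem comp {f : β → σ} {g : α → β} (hf : ComputableIn O f) (hg : ComputableIn O g) :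
    ComputableIn O fun a => f (g a) := by
  refine Nat.RecursiveIn.of_eq (Nat.RecursiveIn.comp hf hg) fun n => ?_
  cases h : (decode n : Option α) <;> simp [Part.bind_eq_bind]

theorem pair {f : α → β} {g : α → γ} (hf : ComputableIn O f) (hg : ComputableIn O g) :
    ComputableIn O fun a => (f a, g a) := by
  refine Nat.RecursiveIn.of_eq (Nat.RecursiveIn.pair hf hg) fun n => ?_
  cases h : (decode n : Option α) <;> simp [Seq.seq]

theorem nat_iff {f : ℕ → ℕ} :
    ComputableIn O f ↔ Nat.RecursiveIn O fun n => Part.some (f n) :=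
  RecursiveIn.iff_nat

/-- A function obtained by iterating a partial `O`-recursive function. -/
theorem of_mem_succ {F : ℕ →. ℕ} (hF : Nat.RecursiveIn O F) {f : ℕ → ℕ}
    (hf : ∀ n, f (n + 1) ∈ F (Nat.pair n (f n))) : ComputableIn O f := by
  have hc : Nat.RecursiveIn O fun _ => Part.some (f 0) :=
    nat_iff.1 (ComputableIn.const (O := O) (α := ℕ) (f 0))
  have hp : Nat.RecursiveIn O fun n => Part.some (Nat.pair 0 n) :=
    nat_iff.1 (Primrec.computableIn (Primrec₂.natPair.comp (Primrec.const 0) Primrec.id))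
  refine nat_iff.2 (Nat.RecursiveIn.of_eq
    (((Nat.RecursiveIn.prec hc (hF.comp .right)).comp hp)) fun n => ?_)
  simp only [Part.bind_eq_bind, Part.bind_some, Nat.unpair_pair]
  induction n with
  | zero => rfl
  | succ n ih =>
    simp only [ih, Part.bind_some]
    exact (Part.bind_some _ _).trans (Part.eq_some_iff.2 (hf n))

theorem nat_rec {f : ℕ → σ} {h : ℕ × σ → σ} (hh : ComputableIn O h)
    (hf : ∀ n, f (n + 1) = h (n, f n)) : ComputableIn O f := by
  have key : ComputableIn O fun n => encode (f n) :=
    of_mem_succ hh fun n => by simp [hf]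
  refine Nat.RecursiveIn.of_eq (nat_iff.1 key) fun n => by simp

/-- Unbounded search, with a witness depending on an invariant of the argument. -/
theorem rfind_mem {P : ℕ → ℕ → Prop} [∀ a m, Decidable (P a m)]
    (hP : ComputableIn O fun p : ℕ × ℕ => decide (P p.1 p.2)) :
    ∃ F : ℕ →. ℕ, Nat.RecursiveIn O F ∧
      ∀ a (h : ∃ m, P a m), Nat.find h ∈ F a := by
  have hb : ComputableIn O fun b : Bool => cond b 0 1 :=
    Primrec.computableIn (Primrec.cond .id (.const 0) (.const 1))
  have hu : ComputableIn O Nat.unpair := ComputableIn.unpair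
  have := Nat.RecursiveIn.rfind (nat_iff.1 (hb.comp (hP.comp hu)))
  refine ⟨_, this, fun a h => ?_⟩
  refine Nat.mem_rfind.2 ⟨?_, fun {m} hm => ?_⟩
  · simp [Nat.find_spec h]
  · simp [Nat.find_min h hm]

theorem exists_find {P : ℕ → ℕ → Prop} [∀ a m, Decidable (P a m)]
    (hP : ComputableIn O fun p : ℕ × ℕ => decide (P p.1 p.2)) (h : ∀ a, ∃ m, P a m) :
    ∃ f : ℕ → ℕ, ComputableIn O f ∧ ∀ a, P a (f a) := by
  obtain ⟨F, hF, hF'⟩ := rfind_mem hP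
  refine ⟨fun a => Nat.find (h a), nat_iff.2 (hF.of_eq_tot fun a => hF' a (h a)),
    fun a => Nat.find_spec (h a)⟩

/-- Dependent choice of a sequence by `O`-recursive search. -/
theorem exists_iterate_find {P : ℕ → ℕ → ℕ → Prop} [∀ s c d, Decidable (P s c d)]
    (hP : ComputableIn O fun p : ℕ × ℕ × ℕ => decide (P p.1 p.2.1 p.2.2))
    {Inv : ℕ → Prop} {c₀ : ℕ} (h₀ : Inv c₀) (hex : ∀ s c, Inv c → ∃ d, P s c d)
    (hinv : ∀ s c d, Inv c → P s c d → Inv d) :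
    ∃ f : ℕ → ℕ, ComputableIn O f ∧ f 0 = c₀ ∧ ∀ s, Inv (f s) ∧ P s (f s) (f (s + 1)) := by
  have hP' : ComputableIn O fun p : ℕ × ℕ =>
      decide (P p.1.unpair.1 p.1.unpair.2 p.2) := by
    refine hP.comp (g := fun p : ℕ × ℕ => (p.1.unpair.1, p.1.unpair.2, p.2)) ?_
    exact Primrec.computableIn (.pair (.comp .fst (.comp .unpair .fst))
      (.pair (.comp .snd (.comp .unpair .fst)) .snd))
  obtain ⟨F, hF, hF'⟩ := rfind_mem (P := fun a m => P a.unpair.1 a.unpair.2 m) hP'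
  -- `Inv` need not be decidable: it is carried along only to guarantee that each search terminates
  -- on the orbit of `c₀`.
  let g : ℕ → {c // Inv c} := fun n => Nat.rec ⟨c₀, h₀⟩
    (fun s c => ⟨Nat.find (hex s c.1 c.2), hinv s _ _ c.2 (Nat.find_spec (hex s c.1 c.2))⟩) n
  refine ⟨fun n => (g n).1, of_mem_succ hF fun n => ?_, rfl, fun s => ⟨(g s).2, ?_⟩⟩
  · have h : ∃ m, P (Nat.pair n (g n).1).unpair.1 (Nat.pair n (g n).1).unpair.2 m := by
      simpa using hex n _ (g n).2
    convert! hF' _ h using 1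
    simp [g]
  · exact Nat.find_spec (hex s (g s).1 (g s).2)

end ComputableIn

/-! ### Set oracles, the jump and `Δ⁰₂` sets. -/

section SetOracle

open Classical

variable {α : Type*} [Primcodable α] {O : Set (ℕ →. ℕ)}

theorem recursiveIn_charFun_iff {V : Set ℕ} :
    RecursiveIn O (charFun V) ↔ ComputableIn O fun n => decide (n ∈ V) := by
  constructor
  · intro h
    have h1 : ComputableIn O fun n : ℕ => if n ∈ V then 1 else 0 := h
    have h2 : ComputableIn O fun m : ℕ => decide (m = 1) :=
      Primrec.computableIn (PrimrecRel.decide Primrec.eq |>.comp .id (.const 1))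
    have h3 := h2.comp h1
    refine (congrArg (ComputableIn O) (funext fun n => ?_)).mp h3
    by_cases hn : n ∈ V <;> simp [hn]
  · intro h
    have hb : ComputableIn O fun b : Bool => cond b 1 0 :=
      Primrec.computableIn (Primrec.cond .id (.const 1) (.const 0))
    have h3 : ComputableIn O fun n : ℕ => if n ∈ V then 1 else 0 := by
      refine (congrArg (ComputableIn O) (funext fun n => ?_)).mp (hb.comp h)
      by_cases hn : n ∈ V <;> simp [hn]
    exact h3

theorem setTuringReducible_iff {U V : Set ℕ} :
    SetTuringReducible U V ↔ ComputableIn {charFun V} fun n => decide (n ∈ U) :=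
  recursiveIn_charFun_iff

theorem computableIn_charFun_self (V : Set ℕ) :
    ComputableIn {charFun V} fun n => decide (n ∈ V) :=
  recursiveIn_charFun_iff.1 (RecursiveIn.oracle _ rfl)

theorem initSeg_succ (V : Set ℕ) (n : ℕ) : initSeg V (n + 1) = initSeg V n ++ [decide (n ∈ V)] := by
  simp [initSeg, List.range_succ]

theorem computableIn_initSeg {V : Set ℕ} (hV : ComputableIn O fun n => decide (n ∈ V)) :
    ComputableIn O (initSeg V) := by
  have hc : ComputableIn O fun p : List Bool × Bool => p.1 ++ [p.2] :=
    Primrec.computableIn (Primrec.list_concat.comp .fst .snd)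
  refine ComputableIn.nat_rec (h := fun p => p.2 ++ [decide (p.1 ∈ V)]) ?_ (initSeg_succ V)
  exact hc.comp (ComputableIn.snd.pair (hV.comp ComputableIn.fst))

@[simp]
theorem length_initSeg (V : Set ℕ) (s : ℕ) : (initSeg V s).length = s := by simp [initSeg]

theorem getElem?_initSeg {V : Set ℕ} {s n : ℕ} {b : Bool} :
    (initSeg V s)[n]? = some b ↔ n < s ∧ decide (n ∈ V) = b := by
  simp only [initSeg, List.getElem?_map, Option.map_eq_some_iff]
  grind

/-- `Σ⁰₁` statements about an oracle reduce uniformly to its jump. -/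
theorem exists_computable_mem_turingJump {B : α → ℕ → List Bool → Prop}
    (hB : ComputablePred fun p : α × ℕ × List Bool => B p.1 p.2.1 p.2.2) :
    ∃ f : α → ℕ, Computable f ∧
      ∀ x Z, f x ∈ turingJump Z ↔ ∃ k s, B x k (initSeg Z s) := by
  replace hB := hB.decide
  -- The search reads only the oracle segment and ignores the numerical input, so running the
  -- resulting machine on its own index is harmless.
  let g : α × ℕ →. ℕ := fun p =>
    Nat.rfind fun k => Part.some (decide (B p.1 k ((decode p.2.unpair.2).getD [])))
  have hg : Partrec g := by
    refine Partrec.rfind (p := fun (p : α × ℕ) k =>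
      Part.some (decide (B p.1 k ((decode p.2.unpair.2).getD [])))) ?_
    refine Computable.partrec (Computable.comp (g := fun q : (α × ℕ) × ℕ =>
      (q.1.1, q.2, (decode q.1.2.unpair.2 : Option (List Bool)).getD [])) hB ?_)
    refine Primrec.to_comp ?_
    refine .pair (.comp .fst .fst) (.pair .snd ?_)
    exact Primrec.option_getD.comp (Primrec.decode.comp
      (.comp .snd (.comp .unpair (.comp .snd .fst)))) (.const [])
  obtain ⟨c, hc⟩ := Nat.Partrec.Code.exists_code.1 hg
  refine ⟨fun x => encode (c.curry (encode x)), ?_, fun x Z => ?_⟩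
  · exact Computable.encode.comp
      ((Nat.Partrec.Code.primrec₂_curry.comp (.const c) .encode).to_comp)
  · change (∃ s, _) ↔ _
    rw [exists_comm]
    refine exists_congr fun s => ?_
    simp only [Denumerable.ofNat_encode, Nat.Partrec.Code.eval_curry, hc]
    have : ∀ m, (decode (Nat.pair (encode x) m) : Option (α × ℕ)) = some (x, m) := by
      intro m; simp
    rw [this]
    simp only [Part.coe_some, Part.bind_some, Part.dom_iff_mem]
    constructor
    · rintro ⟨k, hk⟩
      exact ⟨k, by simpa using (Nat.mem_rfind.1 hk).1⟩
    · intro h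
      refine ⟨Nat.find h, Nat.mem_rfind.2 ⟨?_, fun {m} hm => ?_⟩⟩
      · simpa using Nat.find_spec h
      · simpa using Nat.find_min h hm

theorem computableIn_turingJump {B : α → ℕ → List Bool → Prop}
    (hB : ComputablePred fun p : α × ℕ × List Bool => B p.1 p.2.1 p.2.2) {Z : Set ℕ}
    (hZ : ComputableIn O fun n => decide (n ∈ turingJump Z)) :
    ComputableIn O fun x => decide (∃ k s, B x k (initSeg Z s)) := by
  obtain ⟨f, hf, hfB⟩ := exists_computable_mem_turingJump hB
  simp_rw [← hfB]
  exact hZ.comp hf.computableIn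

/-- One half of Post's theorem. -/
theorem IsDelta02.computableIn {A : Set ℕ} (hA : IsDelta02 A)
    (hO : ComputableIn O fun n => decide (n ∈ turingJump ∅)) :
    ComputableIn O fun n => decide (n ∈ A) := by
  obtain ⟨⟨R, ⟨_, hR⟩, hRA⟩, ⟨S, ⟨_, hS⟩, hSA⟩⟩ := hA
  -- The candidate `p.2` carries a side in its lowest bit (`true` for `A`, `false` for the
  -- complement) and a `Σ⁰₂` witness in the remaining bits; `B` says that `y` refutes it. `∅'`
  -- searches for an unrefuted candidate.
  let B : ℕ × ℕ → ℕ → List Bool → Prop := fun p y _ =>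
    cond p.2.bodd (!decide (R (p.1, p.2.div2, y))) (!decide (S (p.1, p.2.div2, y))) = true
  have hB : ComputablePred fun p : (ℕ × ℕ) × ℕ × List Bool => B p.1 p.2.1 p.2.2 := by
    have hq : Computable fun p : (ℕ × ℕ) × ℕ × List Bool => (p.1.1, p.1.2.div2, p.2.1) :=
      Primrec.to_comp (.pair (.comp .fst .fst)
        (.pair (Primrec.nat_div2.comp (.comp .snd .fst)) (.comp .fst .snd)))
    have hb : Computable fun p : (ℕ × ℕ) × ℕ × List Bool => p.1.2.bodd :=
      Primrec.to_comp (Primrec.nat_bodd.comp (.comp .snd .fst))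
    have := Computable.cond hb ((Primrec.not.to_comp).comp (hR.comp hq))
      ((Primrec.not.to_comp).comp (hS.comp hq))
    refine ⟨Classical.decPred _, this.of_eq fun p => ?_⟩
    simp [B]
  have hP := computableIn_turingJump hB hO
  have hP' : ComputableIn O fun p : ℕ × ℕ => decide (¬ ∃ k s, B p k (initSeg ∅ s)) := by
    simp only [decide_not]
    exact (Primrec.not.computableIn (O := O)).comp hP
  obtain ⟨f, hf, hfP⟩ := ComputableIn.exists_find (P := fun a m => ¬ ∃ k s, B (a, m) k (initSeg ∅ s))
    hP' (by
      intro n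
      by_cases hn : n ∈ A
      · obtain ⟨x, hx⟩ := (hRA n).1 hn
        refine ⟨Nat.bit true x, ?_⟩
        simpa [B] using hx
      · obtain ⟨x, hx⟩ := (hSA n).1 hn
        refine ⟨Nat.bit false x, ?_⟩
        simpa [B] using hx)
  refine (congrArg (ComputableIn O) (funext fun n => ?_)).mp
    ((Primrec.nat_bodd.computableIn (O := O)).comp hf)
  have := hfP n
  cases hb : (f n).bodd
  · simp only [B, hb, cond_false, not_exists, Bool.not_eq_true', decide_eq_false_iff_not, not_not] at this
    have : n ∈ Aᶜ := (hSA n).2 ⟨_, fun y => this y 0⟩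
    simpa using this
  · simp only [B, hb, cond_true, not_exists, Bool.not_eq_true', decide_eq_false_iff_not, not_not] at this
    simpa using (hRA n).2 ⟨_, fun y => this y 0⟩

end SetOracle

/-! ### Halting with a finite oracle string. -/

/-- Some initial segment of `τ` makes the `e`-th oracle machine halt on input `e`. -/
def HaltsWithin (e : ℕ) (τ : List Bool) : Prop :=
  ∃ m, ((Denumerable.ofNat Nat.Partrec.Code e).eval (Nat.pair e (encode (τ.take m)))).Dom

/-- The computation witnessing `HaltsWithin e τ` on the prefix of length `m` takes `t` steps. -/
def HaltsIn (e : ℕ) (τ : List Bool) (m t : ℕ) : Prop :=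
  ((Denumerable.ofNat Nat.Partrec.Code e).evaln t
    (Nat.pair e (encode (τ.take m)))).isSome = true

theorem haltsWithin_iff {e : ℕ} {τ : List Bool} :
    HaltsWithin e τ ↔ ∃ m t, HaltsIn e τ m t := by
  refine exists_congr fun m => ?_
  simp only [HaltsIn, Part.dom_iff_mem, Nat.Partrec.Code.evaln_complete, Option.isSome_iff_exists,
    Option.mem_def]
  exact exists_comm

theorem HaltsWithin.mono {e : ℕ} {τ τ' : List Bool} (h : HaltsWithin e τ) (hτ : τ <+: τ') :
    HaltsWithin e τ' := by
  obtain ⟨m, hm⟩ := h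
  obtain ⟨ρ, rfl⟩ := hτ
  by_cases hl : m ≤ τ.length
  · exact ⟨m, by rwa [List.take_append_of_le_length hl]⟩
  · refine ⟨τ.length, ?_⟩
    rw [List.take_of_length_le (by omega)] at hm
    rwa [List.take_append_of_le_length le_rfl, List.take_length]

theorem initSeg_prefix (V : Set ℕ) {s t : ℕ} (h : s ≤ t) : initSeg V s <+: initSeg V t := by
  obtain ⟨k, rfl⟩ := Nat.exists_eq_add_of_le h
  simp [initSeg, List.range_add]

theorem take_initSeg (V : Set ℕ) {s t : ℕ} (h : s ≤ t) :
    (initSeg V t).take s = initSeg V s := by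
  have := List.prefix_iff_eq_take.1 (initSeg_prefix V h)
  rw [length_initSeg] at this
  exact this.symm

/-- Passing from one exact oracle segment to any prefix of a string makes halting monotone in the
string, as forcing requires. -/
theorem mem_turingJump_iff {e : ℕ} {V : Set ℕ} :
    e ∈ turingJump V ↔ ∃ s, HaltsWithin e (initSeg V s) := by
  constructor
  · rintro ⟨s, hs⟩
    exact ⟨s, s, by rwa [take_initSeg V le_rfl]⟩
  · rintro ⟨s, m, hm⟩
    rcases le_total m s with h | h
    · exact ⟨m, by rwa [take_initSeg V h] at hm⟩
    · exact ⟨s, by rwa [List.take_of_length_le (by simpa using h)] at hm⟩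

/-! ### The avoiding sets as a `Π⁰₁` class. -/

/-- `n` is a position outside the domain of `σ` at which `τ` has the value `1`. -/
def IsNewOne (σ τ : List Bool) (n : ℕ) : Prop :=
  σ.length ≤ n ∧ τ[n]? = some true

/-- `P` is a subset of `Y` meeting every `D ⊆ Y` enumerated by `R`, and no extension of `σ` by
elements of `P` makes the `e`-th oracle machine halt. -/
structure IsAvoiding (P Y R : Set ℕ) (σ : List Bool) (e : ℕ) : Prop where
  subset : P ⊆ Y
  meets : ∀ D : Finset ℕ, ∀ w, Nat.pair (canonicalIndex D) w ∈ R → (D : Set ℕ) ⊆ Y →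
    ∃ d ∈ D, d ∈ P
  not_halts : ∀ τ, σ <+: τ → (∀ n, IsNewOne σ τ n → n ∈ P) → ¬ HaltsWithin e τ

/-- `k` witnesses the failure of `IsAvoiding`, as far as the partial oracles `p`, `y`, `r` tell. -/
def BadWitness (p y r : ℕ → Option Bool) (σ : List Bool) (e k : ℕ) : Prop :=
  (p k = some true ∧ y k = some false) ∨
  (r k = some true ∧ ∀ n < k.unpair.1, Nat.testBit k.unpair.1 n = true →
    y n = some true ∧ p n = some false) ∨
  let τ := ((decode k.unpair.1 : Option (List Bool)).getD [])
  (τ.take σ.length = σ ∧ (∀ n < τ.length, σ.length ≤ n → τ[n]? = some true → p n = some true)) ∧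
    HaltsIn e τ k.unpair.2.unpair.1 k.unpair.2.unpair.2

/-- Every clause asks for definite oracle answers and none for a missing answer, so more information
cannot destroy a witness. -/
theorem BadWitness.mono {p y r p' y' r' : ℕ → Option Bool} {σ : List Bool} {e k : ℕ}
    (hp : ∀ n b, p n = some b → p' n = some b) (hy : ∀ n b, y n = some b → y' n = some b)
    (hr : ∀ n b, r n = some b → r' n = some b) (h : BadWitness p y r σ e k) :
    BadWitness p' y' r' σ e k := by
  rcases h with h | h | h
  · exact .inl ⟨hp _ _ h.1, hy _ _ h.2⟩
  · exact .inr (.inl ⟨hr _ _ h.1, fun n hn hb => ⟨hy _ _ (h.2 n hn hb).1, hp _ _ (h.2 n hn hb).2⟩⟩)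
  · exact .inr (.inr ⟨⟨h.1.1, fun n hn hl ht => hp _ _ (h.1.2 n hn hl ht)⟩, h.2⟩)

open Classical in
/-- The partial oracles `a s` converge to the set `V`. -/
def Approximates (a : ℕ → ℕ → Option Bool) (V : Set ℕ) : Prop :=
  (∀ s n b, a s n = some b → decide (n ∈ V) = b) ∧
    ∀ n, ∃ s₀, ∀ s ≥ s₀, a s n = some (decide (n ∈ V))

theorem approximates_initSeg (V : Set ℕ) (h : ℕ → ℕ) :
    Approximates (fun s n => (initSeg V s)[h n]?) (h ⁻¹' V) := by
  refine ⟨fun s n b hb => (getElem?_initSeg.1 hb).2, fun n => ⟨h n + 1, fun s hs => ?_⟩⟩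
  exact getElem?_initSeg.2 ⟨by omega, rfl⟩

theorem Approximates.exists_forall_lt {a : ℕ → ℕ → Option Bool} {V : Set ℕ}
    (ha : Approximates a V) (N : ℕ) :
    ∃ s₀, ∀ s ≥ s₀, ∀ n < N, (n ∈ V → a s n = some true) ∧ (n ∉ V → a s n = some false) := by
  classical
  choose f hf using ha.2
  refine ⟨(Finset.range N).sup f, fun s hs n hn => ?_⟩
  have := hf n s (le_trans (Finset.le_sup (f := f) (Finset.mem_range.2 hn)) hs)
  constructor <;> intro h <;> simpa [h] using this

theorem mem_iff_testBit_canonicalIndex {D : Finset ℕ} {n : ℕ} :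
    n ∈ D ↔ Nat.testBit (canonicalIndex D) n = true := by
  rw [← Nat.mem_bitIndices, ← List.mem_toFinset, canonicalIndex,
    Finset.toFinset_bitIndices_sum_two_pow]

theorem lt_canonicalIndex_of_mem {D : Finset ℕ} {n : ℕ} (h : n ∈ D) : n < canonicalIndex D :=
  Finset.lt_geomSum_of_mem le_rfl h

theorem exists_canonicalIndex_eq (d : ℕ) : ∃ D : Finset ℕ, canonicalIndex D = d :=
  ⟨d.bitIndices.toFinset, Finset.sum_toFinset_bitIndices_two_pow d⟩

/-- A violation of any of the three clauses is a finite event: a point, a pair `(D, w)`, or a string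
with a halting computation, each coded by `k`. Approximations never answer wrongly and settle on any
finite set. The default string `[]` for an invalid code is harmless, since it is tested like any
other string. -/
theorem isAvoiding_iff {P Y R : Set ℕ} {σ : List Bool} {e : ℕ} {p y r : ℕ → ℕ → Option Bool}
    (hp : Approximates p P) (hy : Approximates y Y) (hr : Approximates r R) :
    IsAvoiding P Y R σ e ↔ ¬ ∃ k s, BadWitness (p s) (y s) (r s) σ e k := by
  constructor
  · rintro h ⟨k, s, ⟨h1, h2⟩ | ⟨h1, h2⟩ | ⟨⟨h1, h2⟩, h3⟩⟩
    · have h1 := hp.1 _ _ _ h1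
      have h2 := hy.1 _ _ _ h2
      simp only [decide_eq_true_eq, decide_eq_false_iff_not] at h1 h2
      exact h2 (h.subset h1)
    · obtain ⟨D, hD⟩ := exists_canonicalIndex_eq k.unpair.1
      rw [← hD] at h2
      have h1 := hr.1 _ _ _ h1
      have key : ∀ n ∈ D, n ∈ Y ∧ n ∉ P := fun n hn => by
        have := h2 n (lt_canonicalIndex_of_mem hn) (mem_iff_testBit_canonicalIndex.1 hn)
        exact ⟨by simpa using hy.1 _ _ _ this.1, by simpa using hp.1 _ _ _ this.2⟩
      obtain ⟨d, hd, hdP⟩ := h.meets D k.unpair.2 (by rw [hD, Nat.pair_unpair]; simpa using h1)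
        fun n hn => (key n hn).1
      exact (key d hd).2 hdP
    · refine h.not_halts _ (List.prefix_iff_eq_take.2 h1.symm) (fun n hn => ?_)
        (haltsWithin_iff.2 ⟨_, _, h3⟩)
      have := h2 n (List.getElem?_eq_some_iff.1 hn.2).1 hn.1 hn.2
      simpa using hp.1 _ _ _ this
  · intro h
    refine ⟨fun n hn => ?_, fun D w hw hDY => ?_, fun τ hσ hτ hh => ?_⟩
    · by_contra hnY
      obtain ⟨s₁, h₁⟩ := hp.exists_forall_lt (n + 1)
      obtain ⟨s₂, h₂⟩ := hy.exists_forall_lt (n + 1)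
      exact h ⟨n, max s₁ s₂, .inl ⟨(h₁ _ (le_max_left _ _) n n.lt_succ_self).1 hn,
        (h₂ _ (le_max_right _ _) n n.lt_succ_self).2 hnY⟩⟩
    · by_contra hD
      push Not at hD
      set k := Nat.pair (canonicalIndex D) w with hk
      obtain ⟨s₁, h₁⟩ := hp.exists_forall_lt (canonicalIndex D)
      obtain ⟨s₂, h₂⟩ := hy.exists_forall_lt (canonicalIndex D)
      obtain ⟨s₃, h₃⟩ := hr.exists_forall_lt (k + 1)
      refine h ⟨k, max s₁ (max s₂ s₃), .inr (.inl ⟨(h₃ _ (by simp) k k.lt_succ_self).1 hw, ?_⟩)⟩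
      intro n hn hb
      simp only [hk, Nat.unpair_pair] at hn hb
      have hnD := mem_iff_testBit_canonicalIndex.2 hb
      exact ⟨(h₂ _ (by simp) n hn).1 (hDY hnD), (h₁ _ (by simp) n hn).2 (hD n hnD)⟩
    · obtain ⟨m, t, hmt⟩ := haltsWithin_iff.1 hh
      obtain ⟨s₁, h₁⟩ := hp.exists_forall_lt τ.length
      refine h ⟨Nat.pair (encode τ) (Nat.pair m t), s₁, .inr (.inr ?_)⟩
      simp only [Nat.unpair_pair, encodek, Option.getD_some]
      exact ⟨⟨(List.prefix_iff_eq_take.1 hσ).symm,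
        fun n hn hl ht => (h₁ _ le_rfl n hn).1 (hτ n ⟨hl, ht⟩)⟩, hmt⟩

/-! ### Primitive recursiveness of the witness relations. -/

section Primrec

variable {α : Type*} [Primcodable α]

theorem PrimrecPred.forall_lt' {f : α → ℕ} {Q : α → ℕ → Prop} (hf : Primrec f)
    (hQ : PrimrecPred fun p : α × ℕ => Q p.1 p.2) : PrimrecPred fun a => ∀ n < f a, Q a n := by
  have h : PrimrecRel fun (n : ℕ) (a : α) => Q a n := hQ.comp (.pair .snd .fst)
  exact (h.forall_mem_list.comp (Primrec.list_range.comp hf) .id).of_eq (by simp)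

theorem PrimrecPred.imp {p q : α → Prop} (hp : PrimrecPred p) (hq : PrimrecPred q) :
    PrimrecPred fun a => p a → q a :=
  (hp.not.or hq).of_eq fun a => by tauto

theorem Primrec.nat_testBit : Primrec₂ Nat.testBit := by
  have h : Primrec fun p : ℕ × ℕ => (Nat.div2^[p.2] p.1).bodd :=
    Primrec.nat_bodd.comp (Primrec.nat_iterate .snd .fst (Primrec.nat_div2.comp .snd))
  refine h.of_eq fun ⟨d, n⟩ => ?_
  induction n generalizing d with
  | zero => simp [Nat.bodd_eq_one_and_ne_zero, Nat.testBit]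
  | succ n ih => simpa [Nat.testBit_succ, Nat.div2_val] using ih (d / 2)

theorem primrecPred_haltsIn {e m t : α → ℕ} {τ : α → List Bool} (he : Primrec e) (hm : Primrec m)
    (ht : Primrec t) (hτ : Primrec τ) : PrimrecPred fun a => HaltsIn (e a) (τ a) (m a) (t a) := by
  refine Primrec.eq.comp (Primrec.option_isSome.comp (Nat.Partrec.Code.primrec_evaln.comp
    (.pair (.pair ht ((Primrec.ofNat _).comp he)) ?_))) (.const true)
  exact Primrec₂.natPair.comp he (Primrec.encode.comp (Primrec.list_take.comp hm hτ))

theorem primrecPred_badWitness {p y r : α → ℕ → Option Bool} {σ : α → List Bool} {e k : α → ℕ}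
    (hp : Primrec₂ p) (hy : Primrec₂ y) (hr : Primrec₂ r) (hσ : Primrec σ) (he : Primrec e)
    (hk : Primrec k) : PrimrecPred fun a => BadWitness (p a) (y a) (r a) (σ a) (e a) (k a) := by
  have hk1 : Primrec fun a => (k a).unpair.1 := .comp .fst (.comp .unpair hk)
  have hk2 : Primrec fun a => (k a).unpair.2 := .comp .snd (.comp .unpair hk)
  have hτ : Primrec fun a => (decode (k a).unpair.1 : Option (List Bool)).getD [] :=
    Primrec.option_getD.comp (Primrec.decode.comp hk1) (.const [])
  refine .or (.and ?_ ?_) (.or (.and ?_ ?_) (.and (.and ?_ ?_) ?_))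
  · exact Primrec.eq.comp (hp.comp .id hk) (.const _)
  · exact Primrec.eq.comp (hy.comp .id hk) (.const _)
  · exact Primrec.eq.comp (hr.comp .id hk) (.const _)
  · refine .forall_lt' hk1 (.imp ?_ (.and ?_ ?_))
    · exact Primrec.eq.comp (Primrec.nat_testBit.comp (hk1.comp .fst) .snd) (.const _)
    · exact Primrec.eq.comp (hy.comp .fst .snd) (.const _)
    · exact Primrec.eq.comp (hp.comp .fst .snd) (.const _)
  · exact Primrec.eq.comp (Primrec.list_take.comp (Primrec.list_length.comp hσ) hτ) hσ
  · refine .forall_lt' (Primrec.list_length.comp hτ) (.imp ?_ (.imp ?_ ?_))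
    · exact Primrec.nat_le.comp (Primrec.list_length.comp (hσ.comp .fst)) .snd
    · exact Primrec.eq.comp (Primrec.list_getElem?.comp (hτ.comp .fst) .snd) (.const _)
    · exact Primrec.eq.comp (hp.comp .fst .snd) (.const _)
  · exact primrecPred_haltsIn he (.comp .fst (.comp .unpair hk2))
      (.comp .snd (.comp .unpair hk2)) hτ

end Primrec

/-! ### Weak König's lemma for `Π⁰₁` classes. -/

open Classical in
/-- Weak König's lemma in a Scott ideal, for a `Π⁰₁` class relative to a member. -/
theorem IsScottIdeal.exists_mem_class {M : Set (Set ℕ)} (hM : IsScottIdeal M) {W : Set ℕ}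
    (hW : W ∈ M) {B : ℕ → List Bool → List Bool → Prop}
    (hB : PrimrecPred fun p : ℕ × List Bool × List Bool => B p.1 p.2.1 p.2.2)
    (hmono : ∀ k ρ ρ' τ τ', ρ <+: ρ' → τ <+: τ' → B k ρ τ → B k ρ' τ')
    {P : Set ℕ} (hP : ¬ ∃ k s, B k (initSeg P s) (initSeg W s)) :
    ∃ Q ∈ M, ¬ ∃ k s, B k (initSeg Q s) (initSeg W s) := by
  -- Bounding `k` by the length makes the tree computable in `W`; monotonicity of `B` makes it
  -- closed under prefixes.
  let T : Set (List Bool) := {ρ | ∀ k < ρ.length, ¬ B k ρ (initSeg W ρ.length)}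
  have hT : IsBinaryTree T := fun σ τ hστ hτ k hk hb =>
    hτ k (hk.trans_le hστ.length_le)
      (hmono _ _ _ _ _ hστ (initSeg_prefix W hστ.length_le) hb)
  have hPT : ∀ s, initSeg P s ∈ T := fun s k _ hb => hP ⟨k, s, by simpa using hb⟩
  have hinf : T.Infinite := by
    refine Set.infinite_of_injective_forall_mem (f := initSeg P) (fun s t h => ?_) hPT
    simpa using congrArg List.length h
  have hTM : encode '' T ∈ M := by
    refine hM.downward W _ hW (setTuringReducible_iff.2 ?_)
    have h1 : PrimrecPred fun p : ℕ × List Bool × List Bool =>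
        encode p.2.1 = p.1 ∧ ∀ k < p.2.1.length, ¬ B k p.2.1 p.2.2 := by
      refine .and (Primrec.eq.comp (Primrec.encode.comp (.comp .fst .snd)) .fst)
        (.forall_lt' (Primrec.list_length.comp (.comp .fst .snd)) (.not ?_))
      exact hB.comp (.pair .snd (.pair (.comp .fst (.comp .snd .fst)) (.comp .snd (.comp .snd .fst))))
    have hd : Primrec fun n => (decode n : Option (List Bool)).getD [] :=
      Primrec.option_getD.comp Primrec.decode (.const [])
    have h2 := (h1.decide.computableIn (O := {charFun W})).comp
      (ComputableIn.id.pair (hd.computableIn.pair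
        ((computableIn_initSeg (computableIn_charFun_self W)).comp
          (Primrec.list_length.comp hd).computableIn)))
    refine (congrArg (ComputableIn _) (funext fun n => ?_)).mp h2
    simp only [decide_eq_decide, Set.mem_image, id]
    constructor
    · rintro ⟨h, h'⟩
      exact ⟨_, h', h⟩
    · rintro ⟨ρ, hρ, rfl⟩
      have hρ' : ∀ k < ρ.length, ¬ B k ρ (initSeg W ρ.length) := hρ
      simpa using hρ'
  obtain ⟨Q, hQ, hQT⟩ := hM.wkl T hT hinf hTM
  refine ⟨Q, hQ, ?_⟩
  rintro ⟨k, s, hb⟩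
  -- The segment must contain the one of length `s` and be strictly longer than `k`, so that the
  -- tree tests `k`.
  refine hQT (max s (k + 1)) k (by simp) ?_
  rw [length_initSeg]
  exact hmono _ _ _ _ _ (initSeg_prefix _ (le_max_left _ _)) (initSeg_prefix _ (le_max_left _ _)) hb

theorem setJoin_preimage_even (Y R : Set ℕ) : (fun n => 2 * n) ⁻¹' setJoin Y R = Y := by
  ext n; simp [setJoin]; grind

theorem setJoin_preimage_odd (Y R : Set ℕ) : (fun n => 2 * n + 1) ⁻¹' setJoin Y R = R := by
  ext n; simp [setJoin]; grind

/-- `P` need not lie in `M`; it only shows that the class, which is `Π⁰₁` in `Y ⊕ R`, is non-empty.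
-/
theorem IsScottIdeal.exists_isAvoiding {M : Set (Set ℕ)} (hM : IsScottIdeal M) {P Y R : Set ℕ}
    (hY : Y ∈ M) (hR : R ∈ M) {σ : List Bool} {e : ℕ} (h : IsAvoiding P Y R σ e) :
    ∃ Q ∈ M, IsAvoiding Q Y R σ e := by
  have key : ∀ P : Set ℕ, IsAvoiding P Y R σ e ↔ ¬ ∃ k s,
      BadWitness (fun n => (initSeg P s)[n]?) (fun n => (initSeg (setJoin Y R) s)[2 * n]?)
        (fun n => (initSeg (setJoin Y R) s)[2 * n + 1]?) σ e k := fun P => by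
    refine isAvoiding_iff (approximates_initSeg P id) ?_ ?_
    · simpa only [setJoin_preimage_even] using approximates_initSeg (setJoin Y R) fun n => 2 * n
    · simpa only [setJoin_preimage_odd] using approximates_initSeg (setJoin Y R) fun n => 2 * n + 1
  simp only [key] at h ⊢
  refine hM.exists_mem_class (hM.join _ _ hY hR) (B := fun k ρ τ => BadWitness (fun n => ρ[n]?)
    (fun n => τ[2 * n]?) (fun n => τ[2 * n + 1]?) σ e k) ?_ ?_ h
  · refine primrecPred_badWitness ?_ ?_ ?_ (.const _) (.const _) .fst
    · exact Primrec.list_getElem?.comp (.comp .fst (.comp .snd .fst)) .snd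
    · exact Primrec.list_getElem?.comp (.comp .snd (.comp .snd .fst))
        (Primrec.nat_double.comp .snd)
    · exact Primrec.list_getElem?.comp (.comp .snd (.comp .snd .fst))
        (Primrec.nat_double_succ.comp .snd)
  · intro k ρ ρ' τ τ' hρ hτ
    have aux : ∀ {l l' : List Bool}, l <+: l' →
        ∀ (n : ℕ) (b : Bool), l[n]? = some b → l'[n]? = some b := by
      rintro l _ ⟨l', rfl⟩ n b h
      rw [List.getElem?_append_left (List.getElem?_eq_some_iff.1 h).1, h]
    exact BadWitness.mono (aux hρ) (fun n => aux hτ (2 * n)) (fun n => aux hτ (2 * n + 1))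

/-! ### Conditions and the complexity of the extension relation. -/

/-- The `i`-th column of `Z`. -/
def setColumn (Z : Set ℕ) (i : ℕ) : Set ℕ := {n | Nat.pair i n ∈ Z}

/-- A condition `(b, σ, i)`: a finite string `σ` together with a reservoir given by the index `i`;
the flag `b` records which alternative was taken at the last step. -/
abbrev Condition := ℕ × List Bool × ℕ

/-- The condition `d` extends `c` and decides whether `e` belongs to the jump of the generic set. -/
structure IsDecidingExtension (A : Set ℕ) (Y : ℕ → Set ℕ) (R : Set ℕ) (e : ℕ)
    (c d : Condition) : Prop where
  isPrefix : c.2.1 <+: d.2.1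
  exists_newOne : ∃ n, IsNewOne c.2.1 d.2.1 n
  mem : ∀ n, IsNewOne c.2.1 d.2.1 n → n ∈ A
  mem_reservoir : ∀ n, IsNewOne c.2.1 d.2.1 n → n ∈ Y c.2.2
  decides : (d.1 = 1 ∧ d.2.2 = c.2.2 ∧ HaltsWithin e d.2.1) ∨
    (d.1 ≠ 1 ∧ IsAvoiding (Y d.2.2) (Y c.2.2) R d.2.1 e)

section Decidability

open Classical

variable {O : Set (ℕ →. ℕ)}

/-- The part of `IsDecidingExtension` that concerns the strings only; `α` is an initial segment
of `A`. -/
def StringsExtend (c d : Condition) (α : List Bool) : Prop :=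
  d.2.1.take c.2.1.length = c.2.1 ∧
  (¬ ∀ n < d.2.1.length, c.2.1.length ≤ n → ¬ d.2.1[n]? = some true) ∧
  ∀ n < d.2.1.length, c.2.1.length ≤ n → d.2.1[n]? = some true → α[n]? = some true

/-- Given the initial segment `ζ` of `Z`, the number `k` witnesses success of a halting extension,
or failure of an avoiding one. -/
def ReservoirWitness (r e : ℕ) (c d : Condition) (k : ℕ) (ζ : List Bool) : Prop :=
  (d.1 = 1 ∧ d.2.2 = c.2.2 ∧ HaltsIn e d.2.1 k.unpair.1 k.unpair.2 ∧
    ∀ n < d.2.1.length, c.2.1.length ≤ n → d.2.1[n]? = some true →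
      ζ[Nat.pair c.2.2 n]? = some true) ∨
  (d.1 ≠ 1 ∧
    (BadWitness (fun n => ζ[Nat.pair d.2.2 n]?) (fun n => ζ[Nat.pair c.2.2 n]?)
      (fun n => ζ[Nat.pair r n]?) d.2.1 e k ∨
    ((c.2.1.length ≤ k ∧ d.2.1[k]? = some true) ∧ ζ[Nat.pair c.2.2 k]? = some false)))

/-- The flag turns a `Σ⁰₁` and a `Π⁰₁` alternative into a single question to `Z'`: with flag `1` a
witness confirms the extension and must exist; otherwise a witness refutes it and must not exist. -/
theorem isDecidingExtension_iff {A Z : Set ℕ} {r e : ℕ} {c d : Condition} :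
    IsDecidingExtension A (setColumn Z) (setColumn Z r) e c d ↔
      StringsExtend c d (initSeg A d.2.1.length) ∧
        ((∃ k s, ReservoirWitness r e c d k (initSeg Z s)) ↔ d.1 = 1) := by
  obtain ⟨b, σ, i⟩ := c
  obtain ⟨b', τ, j⟩ := d
  have hcol : ∀ i, Approximates (fun s n => (initSeg Z s)[Nat.pair i n]?) (setColumn Z i) :=
    fun i => approximates_initSeg Z (Nat.pair i)
  have hnew : ∀ {n}, τ[n]? = some true → n < τ.length := fun h =>
    (List.getElem?_eq_some_iff.1 h).1
  have hstr : StringsExtend (b, σ, i) (b', τ, j) (initSeg A τ.length) ↔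
      σ <+: τ ∧ (∃ n, IsNewOne σ τ n) ∧ ∀ n, IsNewOne σ τ n → n ∈ A := by
    refine and_congr (by rw [List.prefix_iff_eq_take, eq_comm]) (and_congr ?_ ?_)
    · push Not
      exact ⟨fun ⟨n, _, h⟩ => ⟨n, h⟩, fun ⟨n, h⟩ => ⟨n, hnew h.2, h⟩⟩
    · simp only [getElem?_initSeg, decide_eq_true_eq, IsNewOne]
      exact ⟨fun h n hn => (h n (hnew hn.2) hn.1 hn.2).2, fun h n hn h1 h2 => ⟨hn, h n ⟨h1, h2⟩⟩⟩
  have hres : ((∃ k s, ReservoirWitness r e (b, σ, i) (b', τ, j) k (initSeg Z s)) ↔ b' = 1) ↔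
      (∀ n, IsNewOne σ τ n → n ∈ setColumn Z i) ∧ ((b' = 1 ∧ j = i ∧ HaltsWithin e τ) ∨
        (b' ≠ 1 ∧ IsAvoiding (setColumn Z j) (setColumn Z i) (setColumn Z r) τ e)) := by
    by_cases hb : b' = 1
    · subst hb
      simp only [ReservoirWitness, ne_eq, not_true_eq_false, false_and, or_false, iff_true, true_and]
      constructor
      · rintro ⟨k, s, hji, hk, h⟩
        refine ⟨fun n hn => ?_, hji, haltsWithin_iff.2 ⟨_, _, hk⟩⟩
        simpa using (hcol i).1 _ _ _ (h n (hnew hn.2) hn.1 hn.2)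
      · rintro ⟨h, hji, hh⟩
        obtain ⟨m, t, hmt⟩ := haltsWithin_iff.1 hh
        obtain ⟨s, hs⟩ := (hcol i).exists_forall_lt τ.length
        exact ⟨Nat.pair m t, s, hji, by simpa using hmt,
          fun n hn h1 h2 => (hs s le_rfl n hn).1 (h n ⟨h1, h2⟩)⟩
    · simp only [ReservoirWitness, hb, ne_eq, not_false_eq_true, false_and, false_or, true_and,
        iff_false, exists_or, not_or, isAvoiding_iff (hcol j) (hcol i) (hcol r)]
      rw [and_comm]
      refine and_congr_left' ⟨fun h n hn => ?_, fun h => ?_⟩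
      · by_contra hni
        obtain ⟨s, hs⟩ := (hcol i).exists_forall_lt (n + 1)
        exact h ⟨n, s, hn, (hs s le_rfl n n.lt_succ_self).2 hni⟩
      · rintro ⟨k, s, hn, hk⟩
        have := (hcol i).1 _ _ _ hk
        simp only [decide_eq_false_iff_not] at this
        exact this (h k hn)
  rw [hstr, hres]
  exact ⟨fun h => ⟨⟨h.1, h.2, h.3⟩, h.4, h.5⟩, fun h => ⟨h.1.1, h.1.2.1, h.1.2.2, h.2.1, h.2.2⟩⟩

theorem primrecPred_stringsExtend : PrimrecPred fun p : (Condition × Condition) × List Bool =>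
    StringsExtend p.1.1 p.1.2 p.2 := by
  have hσ : Primrec fun p : (Condition × Condition) × List Bool => p.1.1.2.1 :=
    .comp .fst (.comp .snd (.comp .fst .fst))
  have hτ : Primrec fun p : (Condition × Condition) × List Bool => p.1.2.2.1 :=
    .comp .fst (.comp .snd (.comp .snd .fst))
  have h1 : PrimrecPred fun q : ((Condition × Condition) × List Bool) × ℕ =>
      q.1.1.1.2.1.length ≤ q.2 :=
    Primrec.nat_le.comp (Primrec.list_length.comp (hσ.comp .fst)) .snd
  have h2 : PrimrecPred fun q : ((Condition × Condition) × List Bool) × ℕ =>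
      q.1.1.2.2.1[q.2]? = some true :=
    Primrec.eq.comp (Primrec.list_getElem?.comp (hτ.comp .fst) .snd) (.const _)
  refine .and ?_ (.and (.not ?_) ?_)
  · exact Primrec.eq.comp (Primrec.list_take.comp (Primrec.list_length.comp hσ) hτ) hσ
  · exact .forall_lt' (Primrec.list_length.comp hτ) (h1.imp h2.not)
  · refine .forall_lt' (Primrec.list_length.comp hτ) (h1.imp (h2.imp ?_))
    exact Primrec.eq.comp (Primrec.list_getElem?.comp (.comp .snd .fst) .snd) (.const _)

theorem primrecPred_reservoirWitness {α : Type*} [Primcodable α] (r : ℕ) {e k : α → ℕ}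
    {c d : α → Condition} {ζ : α → List Bool} (he : Primrec e) (hk : Primrec k) (hc : Primrec c)
    (hd : Primrec d) (hζ : Primrec ζ) :
    PrimrecPred fun a => ReservoirWitness r (e a) (c a) (d a) (k a) (ζ a) := by
  have hσ : Primrec fun a => (c a).2.1 := .comp .fst (.comp .snd hc)
  have hτ : Primrec fun a => (d a).2.1 := .comp .fst (.comp .snd hd)
  have hi : Primrec fun a => (c a).2.2 := .comp .snd (.comp .snd hc)
  have hj : Primrec fun a => (d a).2.2 := .comp .snd (.comp .snd hd)
  have hb : PrimrecPred fun a => (d a).1 = 1 := Primrec.eq.comp (.comp .fst hd) (.const _)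
  have hcol : ∀ {f : α → ℕ}, Primrec f → Primrec₂ fun (a : α) (n : ℕ) => (ζ a)[Nat.pair (f a) n]? :=
    fun hf => Primrec.list_getElem?.comp (hζ.comp .fst)
      (Primrec₂.natPair.comp (hf.comp .fst) .snd)
  have hbad := primrecPred_badWitness (hcol hj) (hcol hi) (hcol (.const r)) hτ he hk
  refine .or (hb.and (.and ?_ (.and ?_ ?_))) (hb.not.and (.or ?_ (.and (.and ?_ ?_) ?_)))
  · exact Primrec.eq.comp hj hi
  · exact primrecPred_haltsIn he (.comp .fst (.comp .unpair hk)) (.comp .snd (.comp .unpair hk)) hτ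
  · refine .forall_lt' (Primrec.list_length.comp hτ) (.imp ?_ (.imp ?_ ?_))
    · exact Primrec.nat_le.comp (Primrec.list_length.comp (hσ.comp .fst)) .snd
    · exact Primrec.eq.comp (Primrec.list_getElem?.comp (hτ.comp .fst) .snd) (.const _)
    · exact Primrec.eq.comp (hcol hi) (.const _)
  · exact hbad
  · exact Primrec.nat_le.comp (Primrec.list_length.comp hσ) hk
  · exact Primrec.eq.comp (Primrec.list_getElem?.comp hτ hk) (.const _)
  · exact Primrec.eq.comp ((hcol hi).comp .id hk) (.const _)

theorem computableIn_isDecidingExtension {A Z : Set ℕ} (r : ℕ)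
    (hA : ComputableIn O fun n => decide (n ∈ A))
    (hZ : ComputableIn O fun n => decide (n ∈ turingJump Z)) :
    ComputableIn O fun p : ℕ × Condition × Condition =>
      decide (IsDecidingExtension A (setColumn Z) (setColumn Z r) p.1 p.2.1 p.2.2) := by
  have hd : Primrec fun p : ℕ × Condition × Condition => p.2.2 := .comp .snd .snd
  have h1 := (primrecPred_stringsExtend.decide.computableIn (O := O)).comp
    (ComputableIn.snd (α := ℕ).pair ((computableIn_initSeg hA).comp
      (Primrec.list_length.comp (.comp .fst (.comp .snd hd))).computableIn))
  have h2 := computableIn_turingJump (B := fun (p : ℕ × Condition × Condition) k ζ =>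
    ReservoirWitness r p.1 p.2.1 p.2.2 k ζ) (primrecPred_reservoirWitness r (.comp .fst .fst)
      (.comp .fst .snd) (.comp .fst (.comp .snd .fst)) (.comp .snd (.comp .snd .fst))
      (.comp .snd .snd)).computablePred hZ
  have h3 : ComputableIn O fun p : ℕ × Condition × Condition => decide (p.2.2.1 = 1) :=
    (PrimrecPred.decide (Primrec.eq.comp (.comp .fst hd) (.const 1))).computableIn
  have h4 : ComputableIn O fun q : Bool × Bool × Bool => q.1 && (q.2.1 == q.2.2) :=
    Primrec.computableIn (Primrec.and.comp .fst
      (Primrec.beq.comp (.comp .fst .snd) (.comp .snd .snd)))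
  refine (congrArg (ComputableIn O) (funext fun p => ?_)).mp (h4.comp (h1.pair (h2.pair h3)))
  rw [Bool.eq_iff_iff]
  simp [isDecidingExtension_iff]

end Decidability

theorem IsTuringIdeal.diff_mem {M : Set (Set ℕ)} (hM : IsTuringIdeal M) {Y : Set ℕ} (hY : Y ∈ M)
    (m : ℕ) : Y \ Set.Iio m ∈ M := by
  classical
  refine hM.downward Y _ hY (setTuringReducible_iff.2 ?_)
  have h1 : ComputableIn {charFun Y} fun n => decide (m ≤ n) :=
    (PrimrecPred.decide (Primrec.nat_le.comp (.const m) .id)).computableIn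
  have h2 : ComputableIn {charFun Y} fun q : Bool × Bool => q.1 && q.2 :=
    Primrec.computableIn (Primrec.and.comp .fst .snd)
  refine (congrArg (ComputableIn _) (funext fun n => ?_)).mp
    (h2.comp ((computableIn_charFun_self Y).pair h1))
  rw [Bool.eq_iff_iff]
  simp

/-! ### One step of the construction. -/

section Construction

variable {M : Set (Set ℕ)} {A X R : Set ℕ} {φ : Finset ℕ → Prop}

/-- Essentiality is applied to the tail of `Y` from `m` on, which is still an infinite member of
`M`. -/
theorem IsDenselyEssential.exists_mem_ge (hM : IsTuringIdeal M) (hφ : IsDenselyEssential M X φ)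
    {P : Set ℕ} (hP : ∀ D : Finset ℕ, (D : Set ℕ) ⊆ X → φ D → ∃ d ∈ D, d ∈ P) {Y : Set ℕ}
    (hY : Y ∈ M) (hYinf : Y.Infinite) (hYX : Y ⊆ X) (m : ℕ) : ∃ n ≥ m, n ∈ P ∧ n ∈ Y := by
  obtain ⟨D, -, hDY, hD⟩ := hφ _ (hM.diff_mem hY m) (hYinf.sdiff (Set.finite_Iio m))
    (Set.sdiff_subset.trans hYX)
  obtain ⟨d, hd, hdP⟩ := hP D (hDY.trans (Set.sdiff_subset.trans hYX)) hD
  exact ⟨d, by simpa using (hDY hd).2, hdP, (hDY hd).1⟩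

/-- Infinitude is not a clause of the `Π⁰₁` class; it comes from meeting the `φ`-sets found in every
tail of `Y`. -/
theorem IsAvoiding.infinite (hM : IsTuringIdeal M) (hφ : IsDenselyEssential M X φ)
    (hR : ∀ D, φ D ↔ ∃ w, Nat.pair (canonicalIndex D) w ∈ R) {P Y : Set ℕ} (hY : Y ∈ M)
    (hYinf : Y.Infinite) (hYX : Y ⊆ X) {σ : List Bool} {e : ℕ} (h : IsAvoiding P Y R σ e) :
    P.Infinite := by
  refine Set.infinite_of_forall_exists_gt fun m => ?_
  obtain ⟨D, -, hDY, hD⟩ := hφ _ (hM.diff_mem hY (m + 1)) (hYinf.sdiff (Set.finite_Iio _))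
    (Set.sdiff_subset.trans hYX)
  obtain ⟨w, hw⟩ := (hR D).1 hD
  obtain ⟨d, hd, hdP⟩ := h.meets D w hw (hDY.trans Set.sdiff_subset)
  exact ⟨d, hdP, by simpa using (hDY hd).2⟩

theorem exists_isDecidingExtension (hM : IsScottIdeal M) (hφ : IsDenselyEssential M X φ)
    (hR : ∀ D, φ D ↔ ∃ w, Nat.pair (canonicalIndex D) w ∈ R) (hRM : R ∈ M)
    (hA : ∀ D : Finset ℕ, (D : Set ℕ) ⊆ X → φ D → ∃ d ∈ D, d ∈ A)
    {Y : ℕ → Set ℕ} (hYM : M = Set.range Y) (e : ℕ) (c : Condition)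
    (hinf : (Y c.2.2).Infinite) (hX : Y c.2.2 ⊆ X) :
    ∃ d, IsDecidingExtension A Y R e c d := by
  obtain ⟨b, σ, i⟩ := c
  have hi : Y i ∈ M := hYM ▸ ⟨i, rfl⟩
  obtain ⟨n, hn, hnA, hnY⟩ := hφ.exists_mem_ge hM.toIsTuringIdeal hA hi hinf hX σ.length
  -- Padding with zeros makes `n` the only new element, whichever alternative follows.
  let σ₁ := σ ++ List.replicate (n - σ.length) false ++ [true]
  have hσ : σ <+: σ₁ := ⟨_, (List.append_assoc _ _ _).symm⟩
  have hlen : (σ ++ List.replicate (n - σ.length) false).length = n := by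
    simp; omega
  have hone : ∀ k, IsNewOne σ σ₁ k ↔ k = n := by
    intro k
    constructor
    · rintro ⟨h1, h2⟩
      rcases lt_trichotomy k n with h | h | h
      · rw [List.getElem?_append_left (by omega), List.getElem?_append_right h1,
          List.getElem?_replicate] at h2
        split at h2 <;> simp at h2
      · exact h
      · rw [List.getElem?_eq_none] at h2
        · simp at h2
        · simp only [σ₁, List.length_append (bs := [true]), hlen, List.length_singleton]
          omega
    · rintro rfl
      exact ⟨hn, by rw [List.getElem?_append_right (by omega), hlen]; simp⟩
  by_cases hex : ∃ τ, σ₁ <+: τ ∧ (∀ k, IsNewOne σ₁ τ k → k ∈ A ∩ Y i) ∧ HaltsWithin e τ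
  · obtain ⟨τ, hτ, hτA, hh⟩ := hex
    have hall : ∀ k, IsNewOne σ τ k → k ∈ A ∩ Y i := fun k hk => by
      by_cases hk' : σ₁.length ≤ k
      · exact hτA k ⟨hk', hk.2⟩
      · have : σ₁[k]? = some true := by
          obtain ⟨ρ, rfl⟩ := hτ
          have h2 := hk.2
          rwa [List.getElem?_append_left (l₁ := σ₁) (by omega)] at h2
        rw [(hone k).1 ⟨hk.1, this⟩]
        exact ⟨hnA, hnY⟩
    refine ⟨(1, τ, i), hσ.trans hτ, ⟨n, hn, ?_⟩, fun k hk => (hall k hk).1,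
      fun k hk => (hall k hk).2, .inl ⟨rfl, rfl, hh⟩⟩
    have h1 := ((hone n).2 rfl).2
    obtain ⟨ρ, rfl⟩ := hτ
    rw [List.getElem?_append_left (List.getElem?_eq_some_iff.1 h1).1, h1]
  -- The failed search for a halting extension puts `A ∩ Y i` itself in the avoiding class; it is
  -- then replaced by a member of `M`, which need not be contained in `A`.
  · have hav : IsAvoiding (A ∩ Y i) (Y i) R σ₁ e := by
      refine ⟨Set.inter_subset_right, fun D w hw hD => ?_, fun τ hτ hτA hh => hex ⟨τ, hτ, hτA, hh⟩⟩
      obtain ⟨d, hd, hdA⟩ := hA D (hD.trans hX) ((hR D).2 ⟨w, hw⟩)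
      exact ⟨d, hd, hdA, hD hd⟩
    obtain ⟨Q, hQ, hQav⟩ := hM.exists_isAvoiding hi hRM hav
    rw [hYM] at hQ
    obtain ⟨j, rfl⟩ := hQ
    refine ⟨(0, σ₁, j), hσ, ⟨n, (hone n).2 rfl⟩, fun k hk => ?_, fun k hk => ?_,
      .inr ⟨zero_ne_one, hQav⟩⟩ <;> rw [(hone k).1 hk] <;> assumption

end Construction

/-! ### The generic set and its jump. -/

/-- The set built along a sequence of conditions. -/
def genericSet (c : ℕ → Condition) : Set ℕ := {n | ∃ s, (c s).2.1[n]? = some true}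

section Generic

variable {A R : Set ℕ} {Y : ℕ → Set ℕ} {c : ℕ → Condition}

theorem isPrefix_of_isDecidingExtension
    (hc : ∀ s, IsDecidingExtension A Y R s (c s) (c (s + 1))) {s t : ℕ} (h : s ≤ t) :
    (c s).2.1 <+: (c t).2.1 := by
  induction t, h using Nat.le_induction with
  | base => exact List.prefix_rfl
  | succ t _ ih => exact ih.trans (hc t).isPrefix

theorem le_length_of_isDecidingExtension
    (hc : ∀ s, IsDecidingExtension A Y R s (c s) (c (s + 1))) (s : ℕ) : s ≤ (c s).2.1.length := by
  induction s with
  | zero => exact Nat.zero_le _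
  | succ s ih =>
    obtain ⟨n, h1, h2⟩ := (hc s).exists_newOne
    have := (List.getElem?_eq_some_iff.1 h2).1
    omega

theorem initSeg_genericSet (hc : ∀ s, IsDecidingExtension A Y R s (c s) (c (s + 1))) (s : ℕ) :
    initSeg (genericSet c) (c s).2.1.length = (c s).2.1 := by
  classical
  refine List.ext_getElem (length_initSeg _ _) fun n hn hn' => ?_
  have key : n ∈ genericSet c ↔ (c s).2.1[n] = true := by
    constructor
    · rintro ⟨t, ht⟩
      obtain ⟨hnt, ht⟩ := List.getElem?_eq_some_iff.1 ht
      rw [← ht]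
      rcases le_total s t with h | h
      · exact (isPrefix_of_isDecidingExtension hc h).getElem hn'
      · exact ((isPrefix_of_isDecidingExtension hc h).getElem hnt).symm
    · exact fun h => ⟨s, List.getElem?_eq_some_iff.2 ⟨hn', h⟩⟩
  simp [initSeg, key]

theorem reservoir_antitone (hc : ∀ s, IsDecidingExtension A Y R s (c s) (c (s + 1))) {s t : ℕ}
    (h : s ≤ t) : Y (c t).2.2 ⊆ Y (c s).2.2 := by
  induction t, h using Nat.le_induction with
  | base => exact subset_rfl
  | succ t _ ih =>
    refine Set.Subset.trans ?_ ih
    rcases (hc t).decides with ⟨-, h, -⟩ | ⟨-, h⟩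
    · rw [h]
    · exact h.subset

theorem mem_of_isNewOne (hc : ∀ s, IsDecidingExtension A Y R s (c s) (c (s + 1))) {s t : ℕ}
    (h : s ≤ t) {n : ℕ} (hn : IsNewOne (c s).2.1 (c t).2.1 n) : n ∈ A ∧ n ∈ Y (c s).2.2 := by
  induction t, h using Nat.le_induction with
  | base =>
    have := (List.getElem?_eq_some_iff.1 hn.2).1
    have := hn.1
    omega
  | succ t hst ih =>
    by_cases ht : (c t).2.1.length ≤ n
    · exact ⟨(hc t).mem n ⟨ht, hn.2⟩, reservoir_antitone hc hst ((hc t).mem_reservoir n ⟨ht, hn.2⟩)⟩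
    · refine ih ⟨hn.1, ?_⟩
      obtain ⟨ρ, hρ⟩ := (hc t).isPrefix
      have := hn.2
      rwa [← hρ, List.getElem?_append_left (by omega)] at this

/-- Stage `e` settles `e` for good. With flag `1` the string already halts; otherwise all later
elements come from the avoiding reservoir, so a halting segment of the generic set would extend to a
forbidden string. -/
theorem mem_turingJump_genericSet_iff
    (hc : ∀ s, IsDecidingExtension A Y R s (c s) (c (s + 1))) (e : ℕ) :
    e ∈ turingJump (genericSet c) ↔ (c (e + 1)).1 = 1 := by
  rw [mem_turingJump_iff]
  constructor
  · rintro ⟨s, hs⟩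
    rcases (hc e).decides with ⟨h, -⟩ | ⟨-, h⟩
    · exact h
    · let t := max s (e + 1)
      have hst : s ≤ (c t).2.1.length :=
        (le_max_left _ _).trans (le_length_of_isDecidingExtension hc t)
      refine absurd (hs.mono (initSeg_prefix _ hst)) ?_
      rw [initSeg_genericSet hc]
      have het : e + 1 ≤ t := le_max_right _ _
      refine h.not_halts _ (isPrefix_of_isDecidingExtension hc het) fun n hn => ?_
      exact (mem_of_isNewOne hc het hn).2
  · intro h
    rcases (hc e).decides with ⟨-, -, hh⟩ | ⟨h', -⟩
    · exact ⟨_, by rwa [initSeg_genericSet hc]⟩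
    · exact absurd h h'

theorem genericSet_infinite (hc : ∀ s, IsDecidingExtension A Y R s (c s) (c (s + 1))) :
    (genericSet c).Infinite := by
  refine Set.infinite_of_forall_exists_gt fun m => ?_
  obtain ⟨n, h1, h2⟩ := (hc (m + 1)).exists_newOne
  exact ⟨n, ⟨_, h2⟩, (Nat.lt_of_succ_le (le_length_of_isDecidingExtension hc (m + 1))).trans_le h1⟩

theorem genericSet_subset (hc : ∀ s, IsDecidingExtension A Y R s (c s) (c (s + 1)))
    (h₀ : (c 0).2.1 = []) : genericSet c ⊆ A := by
  rintro n ⟨s, hs⟩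
  exact (mem_of_isNewOne hc (Nat.zero_le s) ⟨by simp [h₀], hs⟩).1

end Generic

/-! ### Assembly of the theorem. -/

theorem mainTheorem10 (M : Set (Set ℕ)) (hM : IsScottIdeal M)
    (hlow : ∃ Z : Set ℕ, IsLow Z ∧ CodesFamily Z M)
    (A : Set ℕ) (hA : IsDelta02 A) (hnot : ¬ IsDenselyHyperimmune M A) :
    ∃ G : Set ℕ, IsLow G ∧ G.Infinite ∧ G ⊆ A := by
  classical
  obtain ⟨Z, hZ, hZM⟩ := hlow
  replace hZM : M = Set.range (setColumn Z) := hZM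
  simp only [IsDenselyHyperimmune, not_forall, not_exists, not_and] at hnot
  obtain ⟨X, hX, hXinf, φ, ⟨R, hRX, hR⟩, hφ, hno⟩ := hnot
  have hRM : R ∈ M := hM.downward X R hX hRX
  have hDA : ∀ D : Finset ℕ, (D : Set ℕ) ⊆ X → φ D → ∃ d ∈ D, d ∈ A := by
    intro D hD hφD
    by_contra h
    push Not at h
    exact hno D (fun d hd => ⟨hD hd, h d hd⟩) hφD
  obtain ⟨r, rfl⟩ : R ∈ Set.range (setColumn Z) := hZM ▸ hRM
  obtain ⟨i, hi⟩ : X ∈ Set.range (setColumn Z) := hZM ▸ hX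
  let O : Set (ℕ →. ℕ) := {charFun (turingJump ∅)}
  have hO : ComputableIn O fun n => decide (n ∈ turingJump ∅) := computableIn_charFun_self _
  have hstep := computableIn_isDecidingExtension (O := O) r (hA.computableIn hO)
    (setTuringReducible_iff.1 hZ)
  -- The default value is immaterial, since the search tests conditions only through `dec`.
  let dec : ℕ → Condition := fun n => (decode n).getD (0, [], i)
  have hdec : Primrec dec := Primrec.option_getD.comp Primrec.decode (.const _)
  have hdec_encode : ∀ c, dec (encode c) = c := fun c => by
    change (decode (encode c)).getD _ = c
    rw [encodek]; rfl
  have hP : ComputableIn O fun p : ℕ × ℕ × ℕ => decide (IsDecidingExtension A (setColumn Z)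
      (setColumn Z r) p.1 (dec p.2.1) (dec p.2.2)) :=
    hstep.comp (g := fun p : ℕ × ℕ × ℕ => (p.1, dec p.2.1, dec p.2.2))
      (Primrec.computableIn (.pair .fst (.pair (hdec.comp (.comp .fst .snd))
        (hdec.comp (.comp .snd .snd)))))
  obtain ⟨f, hf, hf₀, hfs⟩ := ComputableIn.exists_iterate_find (P := fun s c d =>
      IsDecidingExtension A (setColumn Z) (setColumn Z r) s (dec c) (dec d)) hP
    (Inv := fun c => (setColumn Z (dec c).2.2).Infinite ∧ setColumn Z (dec c).2.2 ⊆ X)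
    (c₀ := encode ((0, [], i) : Condition))
    (by simp only [hdec_encode, hi]; exact ⟨hXinf, subset_rfl⟩)
    (fun s c hc => by
      obtain ⟨d, hd⟩ := exists_isDecidingExtension hM hφ hR hRM hDA hZM s (dec c) hc.1 hc.2
      exact ⟨encode d, by rwa [hdec_encode]⟩)
    -- The search may return another extension than the one shown to exist, so the invariant is
    -- proved for every deciding extension.
    (fun s c d hc hd => by
      rcases hd.decides with ⟨-, h, -⟩ | ⟨-, h⟩
      · rwa [h]
      · exact ⟨h.infinite hM.toIsTuringIdeal hφ hR (hZM ▸ ⟨_, rfl⟩) hc.1 hc.2,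
          h.subset.trans hc.2⟩)
  have hc : ∀ s, IsDecidingExtension A (setColumn Z) (setColumn Z r) s (dec (f s))
    (dec (f (s + 1))) := fun s => (hfs s).2
  refine ⟨genericSet fun s => dec (f s), setTuringReducible_iff.2 ?_,
    genericSet_infinite hc, genericSet_subset hc (by simp only [hf₀, hdec_encode])⟩
  simp only [mem_turingJump_genericSet_iff hc]
  have hb : Primrec fun n => decide ((dec n).1 = 1) :=
    PrimrecPred.decide (Primrec.eq.comp (.comp .fst hdec) (.const 1))
  exact (hb.computableIn (O := O)).comp (hf.comp ComputableIn.succ)
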